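/- Let $k\ge 1$ be an integer and let $A>0$ be a real number. Then there is a constant $K>0$, depending only on $k$ and $A$, with the following property. Let $\mathbb E$ be a real Banach space, and let $f=(f_{i_1,\dots,i_k})_{i_1,\dots,i_k\in\mathbb N}$ be an array of vectors of $\mathbb E$ with only finitely many non-zero entries that is diagonal-free, i.e. $f_{i_1,\dots,i_k}=0$ whenever at least two of the indices $i_1,\dots,i_k$ are equal. Let $\xi=(\xi_i)_{i\in\mathbb N}$ and $\eta=(\eta_i)_{i\in\mathbb N}$ be two sequences of real random variables (defined on the same or on different probability spaces; no relation between the two sequences is assumed other than the one below), each sequence consisting of independent symmetric random variables (a random variable $X$ is symmetric if $-X$ and $X$ have the same distribution), such that \[ \mathsf P(|\xi_i|>t)\le A\,\mathsf P(|\eta_i|>t)\qquad\text{for all } t>0 \text{ and all } i\in\mathbb N . \] For a sequence $x = (x_i)$ of real random variables put \[ Q(f,x^k)=\sum_{i_1,\dots,i_k} f_{i_1,\dots,i_k}\,x_{i_1}\cdots x_{i_k}. \] Then \[ \mathsf P\bigl(\|Q(f,\xi^k)\|>t\bigr)\le K\,\mathsf P\bigl(K\,\|Q(f,\eta^k)\|>t\bigr)\qquad\text{for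 all } t>0 . \] -/

import Mathlib

open MeasureTheory ProbabilityTheory

/-- A finitely supported array `f = (f_{i_1,…,i_k})`, indexed by `k`-tuples of natural numbers, is
diagonal-free if `f_{i_1,…,i_k} = 0` as soon as two of the indices are equal. -/
def DiagonalFree {E : Type*} [Zero E] {k : ℕ} (f : (Fin k → ℕ) →₀ E) : Prop :=
  ∀ i : Fin k → ℕ, (∃ a b : Fin k, a ≠ b ∧ i a = i b) → f i = 0

/-- The `k`-linear form
`Q(f; x_1, …, x_k) = ∑_{i_1,…,i_k} x_{1,i_1} ⋯ x_{k,i_k} f_{i_1,…,i_k}`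
evaluated at real sequences `x_1, …, x_k`. -/
def multilinearQ {E : Type*} [NormedAddCommGroup E] [NormedSpace ℝ E] {k : ℕ}
    (f : (Fin k → ℕ) →₀ E) (x : Fin k → ℕ → ℝ) : E :=
  f.sum fun i v => (∏ j, x j (i j)) • v

/-- The undecoupled `k`-homogeneous polynomial `Q(f; x^k) = Q(f; x, …, x)`. -/
def homogeneousQ {E : Type*} [NormedAddCommGroup E] [NormedSpace ℝ E] {k : ℕ}
    (f : (Fin k → ℕ) →₀ E) (x : ℕ → ℝ) : E :=
  multilinearQ f fun _ => x

/-- A real random variable `X` is symmetric if `-X` and `X` have the same distribution. -/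
def SymmetricRV {Ω : Type*} [MeasurableSpace Ω] (P : Measure Ω) (X : Ω → ℝ) : Prop :=
  IdentDistrib (fun ω => -X ω) X P P

/-- A sequence of (jointly) independent symmetric real random variables. -/
structure IsIndepSymmetricSeq {Ω : Type*} [MeasurableSpace Ω] (P : Measure Ω)
    (ξ : ℕ → Ω → ℝ) : Prop where
  measurable : ∀ i, Measurable (ξ i)
  indep : iIndepFun ξ P
  symmetric : ∀ i, SymmetricRV P (ξ i)

/-! Since `f` is diagonal-free, the form is a homogeneous multi-affine ("tetrahedral") polynomial of
degree `k` in finitely many coordinates. Everything rests on one anticoncentration fact,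
`exists_anticoncentration`: if the `u i` are independent, bounded by 1, with means `m i` and
variances at least `v`, then `‖T(u y)‖ ≥ ‖T(m y)‖ / 2` with probability bounded below in terms of
`k` and `v` only. A norming functional reduces this to real coefficients. There the mean of `T(u y)`
is `T(m y)`, the fourth moment is controlled by the squared second moment, and a Paley–Zygmund
argument applies.

Randomising the coefficients in this way gives two comparisons. With random signs of mean `θ i / 2`,
`|θ i| ≤ 1`, it yields a contraction principle for Rademacher chaos (`exists_contraction`), because
a fair sign times any fixed sign is again fair. With 0-1 variables of mean `p` it shows that
thinning the variables costs only constants (`exists_thinning_le`).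

Thinning `ξ` with `p A ≤ 1` makes its tails dominated by those of `η` with constant one. Coupling
the moduli by quantile functions then makes the domination pointwise, and by symmetry independent
fair signs may be inserted. Contraction, conditionally on the moduli, finishes the proof
(`exists_comparison`). -/

/-- The tetrahedral polynomial `∑_{I ⊆ s} (∏_{i ∈ I} x_i) c_I`. -/
def tetra {ι E : Type*} [NormedAddCommGroup E] [NormedSpace ℝ E] (s : Finset ι)
    (c : Finset ι → E) (x : ι → ℝ) : E :=
  ∑ I ∈ s.powerset, (∏ i ∈ I, x i) • c I

/-! ### Algebra of tetrahedral polynomials. -/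

section Tetra

variable {ι E : Type*} [NormedAddCommGroup E] [NormedSpace ℝ E]

lemma tetra_insert [DecidableEq ι] {a : ι} {s : Finset ι} (ha : a ∉ s) (c : Finset ι → E)
    (x : ι → ℝ) :
    tetra (insert a s) c x = tetra s c x + x a • tetra s (fun I => c (insert a I)) x := by
  unfold tetra
  rw [Finset.sum_powerset_insert ha, Finset.smul_sum]
  congr 1
  refine Finset.sum_congr rfl fun I hI => ?_
  rw [Finset.prod_insert (fun h => ha (Finset.mem_powerset.1 hI h)), mul_smul]

lemma tetra_add (s : Finset ι) (c d : Finset ι → E) (x : ι → ℝ) :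
    tetra s (c + d) x = tetra s c x + tetra s d x := by
  simp [tetra, smul_add, Finset.sum_add_distrib]

lemma tetra_smul (s : Finset ι) (r : ℝ) (c : Finset ι → E) (x : ι → ℝ) :
    tetra s (r • c) x = r • tetra s c x := by
  simp only [tetra, Finset.smul_sum, Pi.smul_apply]
  exact Finset.sum_congr rfl fun I _ => smul_comm _ _ _

lemma tetra_mul (s : Finset ι) (c : Finset ι → E) (x y : ι → ℝ) :
    tetra s c (x * y) = tetra s (fun I => (∏ i ∈ I, y i) • c I) x := by
  simp only [tetra, Pi.mul_apply, Finset.prod_mul_distrib, mul_smul]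

lemma tetra_smul_arg {k : ℕ} (s : Finset ι) {c : Finset ι → E} (hc : ∀ I, I.card ≠ k → c I = 0)
    (r : ℝ) (x : ι → ℝ) : tetra s c (r • x) = r ^ k • tetra s c x := by
  simp only [tetra, Finset.smul_sum, Pi.smul_apply, smul_eq_mul, Finset.prod_mul_distrib,
    Finset.prod_const]
  refine Finset.sum_congr rfl fun I _ => ?_
  by_cases h : I.card = k
  · rw [h, mul_smul]
  · simp [hc I h]

lemma tetra_eq_const (s : Finset ι) {c : Finset ι → E} (hc : ∀ I, 0 < I.card → c I = 0)
    (x : ι → ℝ) : tetra s c x = c ∅ := by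
  unfold tetra
  rw [Finset.sum_eq_single ∅]
  · simp
  · intro I _ hI
    rw [hc I (Finset.card_pos.2 (Finset.nonempty_iff_ne_empty.2 hI)), smul_zero]
  · simp

lemma map_tetra (s : Finset ι) (c : Finset ι → E) (φ : E →L[ℝ] ℝ) (x : ι → ℝ) :
    φ (tetra s c x) = tetra s (fun I => φ (c I)) x := by
  simp [tetra]

@[fun_prop]
lemma continuous_tetra (s : Finset ι) (c : Finset ι → E) : Continuous (tetra s c) := by
  unfold tetra
  fun_prop

end Tetra

/-! ### Bounded measurable functions, a class closed under all operations needed, so that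
integrability is automatic. -/

/-- Bounded measurable real functions. -/
def BddMeasurable {Ω : Type*} [MeasurableSpace Ω] (f : Ω → ℝ) : Prop :=
  Measurable f ∧ ∃ M, ∀ ω, |f ω| ≤ M

namespace BddMeasurable

variable {Ω : Type*} [MeasurableSpace Ω] {f g : Ω → ℝ}

lemma const (r : ℝ) : BddMeasurable fun _ : Ω => r := ⟨measurable_const, |r|, fun _ => le_rfl⟩

lemma add (hf : BddMeasurable f) (hg : BddMeasurable g) : BddMeasurable fun ω => f ω + g ω := by
  obtain ⟨hf, M, hM⟩ := hf
  obtain ⟨hg, N, hN⟩ := hg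
  exact ⟨hf.add hg, M + N, fun ω => (abs_add_le _ _).trans (add_le_add (hM ω) (hN ω))⟩

lemma mul (hf : BddMeasurable f) (hg : BddMeasurable g) : BddMeasurable fun ω => f ω * g ω := by
  obtain ⟨hf, M, hM⟩ := hf
  obtain ⟨hg, N, hN⟩ := hg
  refine ⟨hf.mul hg, M * N, fun ω => ?_⟩
  rw [abs_mul]
  exact mul_le_mul (hM ω) (hN ω) (abs_nonneg _) ((abs_nonneg _).trans (hM ω))

lemma pow (hf : BddMeasurable f) (n : ℕ) : BddMeasurable fun ω => f ω ^ n := by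
  obtain ⟨hf, M, hM⟩ := hf
  refine ⟨hf.pow_const n, M ^ n, fun ω => ?_⟩
  rw [abs_pow]
  exact pow_le_pow_left₀ (abs_nonneg _) (hM ω) n

lemma sum {κ : Type*} {F : κ → Ω → ℝ} (s : Finset κ) (h : ∀ i ∈ s, BddMeasurable (F i)) :
    BddMeasurable fun ω => ∑ i ∈ s, F i ω := by
  classical
  induction s using Finset.induction_on with
  | empty => simpa using const 0
  | insert a s ha ih =>
    simp only [Finset.sum_insert ha]
    exact (h a (by simp)).add (ih fun i hi => h i (by simp [hi]))

lemma prod {κ : Type*} {F : κ → Ω → ℝ} (s : Finset κ) (h : ∀ i ∈ s, BddMeasurable (F i)) :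
    BddMeasurable fun ω => ∏ i ∈ s, F i ω := by
  classical
  induction s using Finset.induction_on with
  | empty => simpa using const 1
  | insert a s ha ih =>
    simp only [Finset.prod_insert ha]
    exact (h a (by simp)).mul (ih fun i hi => h i (by simp [hi]))

lemma tetra {ι : Type*} {u : ι → Ω → ℝ} (s : Finset ι) (c : Finset ι → ℝ)
    (h : ∀ i, BddMeasurable (u i)) : BddMeasurable fun ω => tetra s c fun i => u i ω := by
  unfold _root_.tetra
  exact sum _ fun I _ => (prod _ fun i _ => h i).mul (const _)

lemma integrable {P : Measure Ω} [IsFiniteMeasure P] (hf : BddMeasurable f) : Integrable f P := by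
  obtain ⟨hf, M, hM⟩ := hf
  exact Integrable.of_bound hf.aestronglyMeasurable M (ae_of_all _ hM)

lemma integral_add {P : Measure Ω} [IsFiniteMeasure P] (hf : BddMeasurable f)
    (hg : BddMeasurable g) : ∫ ω, (f ω + g ω) ∂P = (∫ ω, f ω ∂P) + ∫ ω, g ω ∂P :=
  MeasureTheory.integral_add hf.integrable hg.integrable

lemma const_mul (r : ℝ) (hf : BddMeasurable f) : BddMeasurable fun ω => r * f ω :=
  (const r).mul hf

end BddMeasurable

/-! ### Moment comparison and anticoncentration. -/

section Moments

variable {Ω : Type*} [MeasurableSpace Ω] {P : Measure Ω} [IsProbabilityMeasure P]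

/-- Cauchy–Schwarz, from the discriminant of the nonnegative quadratic `x ↦ E (x f + g)²`. -/
lemma sq_integral_mul_le {f g : Ω → ℝ} (hf : BddMeasurable f) (hg : BddMeasurable g) :
    (∫ ω, f ω * g ω ∂P) ^ 2 ≤ (∫ ω, f ω ^ 2 ∂P) * ∫ ω, g ω ^ 2 ∂P := by
  have key : ∀ x : ℝ, 0 ≤ (∫ ω, f ω ^ 2 ∂P) * (x * x) + (2 * ∫ ω, f ω * g ω ∂P) * x
      + ∫ ω, g ω ^ 2 ∂P := by
    intro x
    have h : 0 ≤ ∫ ω, (x * f ω + g ω) ^ 2 ∂P := integral_nonneg fun ω => sq_nonneg _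
    have e : ∀ ω, (x * f ω + g ω) ^ 2 = (x * x) * f ω ^ 2 + (2 * x) * (f ω * g ω) + g ω ^ 2 :=
      fun ω => by ring
    simp only [e] at h
    rw [BddMeasurable.integral_add (((hf.pow 2).const_mul _).add ((hf.mul hg).const_mul _))
      (hg.pow 2), BddMeasurable.integral_add ((hf.pow 2).const_mul _)
      ((hf.mul hg).const_mul _), integral_const_mul, integral_const_mul] at h
    linarith
  have := discrim_le_zero key
  unfold discrim at this
  nlinarith

omit [IsProbabilityMeasure P] in
lemma integral_comp_mul_of_indep {f g w : Ω → ℝ} (h : IndepFun (fun ω => (f ω, g ω)) w P)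
    (hf : BddMeasurable f) (hg : BddMeasurable g) (hw : BddMeasurable w)
    {F : ℝ × ℝ → ℝ} (hF : Measurable F) {G : ℝ → ℝ} (hG : Measurable G) :
    ∫ ω, F (f ω, g ω) * G (w ω) ∂P = (∫ ω, F (f ω, g ω) ∂P) * ∫ ω, G (w ω) ∂P :=
  h.integral_fun_comp_mul_comp (hf.1.prodMk hg.1).aemeasurable hw.1.aemeasurable
    hF.aestronglyMeasurable hG.aestronglyMeasurable

lemma integral_sq_add_mul {f g w : Ω → ℝ} (h : IndepFun (fun ω => (f ω, g ω)) w P)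
    (hf : BddMeasurable f) (hg : BddMeasurable g) (hw : BddMeasurable w) (hw0 : ∫ ω, w ω ∂P = 0) :
    ∫ ω, (f ω + w ω * g ω) ^ 2 ∂P
      = (∫ ω, f ω ^ 2 ∂P) + (∫ ω, w ω ^ 2 ∂P) * ∫ ω, g ω ^ 2 ∂P := by
  have e : ∀ ω, (f ω + w ω * g ω) ^ 2 = f ω ^ 2 + 2 * (f ω * g ω * w ω) + g ω ^ 2 * w ω ^ 2 :=
    fun ω => by ring
  simp only [e]
  rw [BddMeasurable.integral_add ((hf.pow 2).add (((hf.mul hg).mul hw).const_mul _))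
    ((hg.pow 2).mul (hw.pow 2)),
    BddMeasurable.integral_add (hf.pow 2) (((hf.mul hg).mul hw).const_mul _),
    integral_const_mul]
  have h1 := integral_comp_mul_of_indep h hf hg hw (F := fun z => z.1 * z.2) (by fun_prop)
    (G := fun z => z) (by fun_prop)
  have h2 := integral_comp_mul_of_indep h hf hg hw (F := fun z => z.2 ^ 2) (by fun_prop)
    (G := fun z => z ^ 2) (by fun_prop)
  simp only [hw0] at h1 h2
  rw [h1, h2]
  ring

/-- Induction step of the moment comparison: `f` has degree one more than `g`, hence one more factor
`R ^ 2`. With `X`, `Y`, `σ` the second moments of `f`, `g`, `w`, the cross term and the `g ^ 4` term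
are absorbed into `R ^ 2 * D * (X + σ Y) ^ 2`. -/
lemma integral_pow_four_add_mul_le {f g w : Ω → ℝ} (h : IndepFun (fun ω => (f ω, g ω)) w P)
    (hf : BddMeasurable f) (hg : BddMeasurable g) (hw : Measurable w) (hw2 : ∀ ω, |w ω| ≤ 2)
    (hw0 : ∫ ω, w ω ∂P = 0) {R v D : ℝ} (hR : 4 ≤ R) (hv : 12 ≤ R ^ 2 * v)
    (hwv : v ≤ ∫ ω, w ω ^ 2 ∂P) (hD : 0 ≤ D)
    (hf4 : ∫ ω, f ω ^ 4 ∂P ≤ R ^ 2 * D * (∫ ω, f ω ^ 2 ∂P) ^ 2)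
    (hg4 : ∫ ω, g ω ^ 4 ∂P ≤ D * (∫ ω, g ω ^ 2 ∂P) ^ 2) :
    ∫ ω, (f ω + w ω * g ω) ^ 4 ∂P ≤ R ^ 2 * D * (∫ ω, (f ω + w ω * g ω) ^ 2 ∂P) ^ 2 := by
  have hwb : BddMeasurable w := ⟨hw, 2, hw2⟩
  rw [integral_sq_add_mul h hf hg hwb hw0]
  set X := ∫ ω, f ω ^ 2 ∂P
  set Y := ∫ ω, g ω ^ 2 ∂P
  set σ := ∫ ω, w ω ^ 2 ∂P
  have hX : 0 ≤ X := integral_nonneg fun ω => sq_nonneg _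
  have hY : 0 ≤ Y := integral_nonneg fun ω => sq_nonneg _
  have hσ : 0 ≤ σ := integral_nonneg fun ω => sq_nonneg _
  -- The cubic term is split by `4 f g³ w³ ≤ 2 f² g² w² + 2 g⁴ w⁴`, and then `w⁴ ≤ 4 w²`. The term
  -- linear in `w` is kept, since it integrates to zero.
  have hpt : ∀ ω, (f ω + w ω * g ω) ^ 4 ≤ f ω ^ 4 + 4 * (f ω ^ 3 * g ω * w ω)
      + 8 * ((f ω ^ 2 * g ω ^ 2) * w ω ^ 2) + 12 * (g ω ^ 4 * w ω ^ 2) := by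
    intro ω
    have h4 : w ω ^ 2 ≤ 4 := by
      have := hw2 ω
      rw [abs_le] at this
      nlinarith
    have h5 : g ω ^ 4 * w ω ^ 2 * w ω ^ 2 ≤ g ω ^ 4 * w ω ^ 2 * 4 := by gcongr
    nlinarith [sq_nonneg (f ω * g ω * w ω - g ω ^ 2 * w ω ^ 2)]
  have i1 := hf.pow 4
  have i2 := (((hf.pow 3).mul hg).mul hwb).const_mul 4
  have i3 := (((hf.pow 2).mul (hg.pow 2)).mul (hwb.pow 2)).const_mul 8
  have i4 := ((hg.pow 4).mul (hwb.pow 2)).const_mul 12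
  have hint : ∫ ω, (f ω + w ω * g ω) ^ 4 ∂P ≤ (∫ ω, f ω ^ 4 ∂P)
      + 8 * ((∫ ω, f ω ^ 2 * g ω ^ 2 ∂P) * σ) + 12 * ((∫ ω, g ω ^ 4 ∂P) * σ) := by
    refine (integral_mono ((hf.add (hwb.mul hg)).pow 4).integrable
      (((i1.add i2).add i3).add i4).integrable hpt).trans_eq ?_
    rw [BddMeasurable.integral_add ((i1.add i2).add i3) i4,
      BddMeasurable.integral_add (i1.add i2) i3, BddMeasurable.integral_add i1 i2]
    simp only [integral_const_mul]
    have h1 := integral_comp_mul_of_indep h hf hg hwb (F := fun z => z.1 ^ 3 * z.2) (by fun_prop)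
      (G := fun z => z) (by fun_prop)
    have h2 := integral_comp_mul_of_indep h hf hg hwb (F := fun z => z.1 ^ 2 * z.2 ^ 2)
      (by fun_prop) (G := fun z => z ^ 2) (by fun_prop)
    have h3 := integral_comp_mul_of_indep h hf hg hwb (F := fun z => z.2 ^ 4)
      (by fun_prop) (G := fun z => z ^ 2) (by fun_prop)
    simp only [hw0] at h1 h2 h3
    rw [h1, h2, h3]
    ring
  have hcs : ∫ ω, f ω ^ 2 * g ω ^ 2 ∂P ≤ R * D * X * Y := by
    have hc := sq_integral_mul_le (P := P) (hf.pow 2) (hg.pow 2)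
    simp only [← pow_mul] at hc
    norm_num at hc
    refine abs_le_of_sq_le_sq' ?_ (by positivity) |>.2
    calc _ ≤ _ := hc
      _ ≤ (R ^ 2 * D * X ^ 2) * (D * Y ^ 2) := by
          gcongr
      _ = _ := by ring
  have e1 : (∫ ω, f ω ^ 2 * g ω ^ 2 ∂P) * σ ≤ R * D * X * Y * σ := by gcongr
  have e2 : (∫ ω, g ω ^ 4 ∂P) * σ ≤ D * Y ^ 2 * σ := by gcongr
  have e3 : 4 * (R * (D * X * Y * σ)) ≤ R * (R * (D * X * Y * σ)) := by gcongr
  have e4 : 12 * (D * Y ^ 2 * σ) ≤ (R ^ 2 * σ) * (D * Y ^ 2 * σ) := by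
    gcongr
    exact hv.trans (by gcongr)
  nlinarith

omit [IsProbabilityMeasure P] in
lemma indepFun_tetra_pair {ι : Type*} [DecidableEq ι] {u : ι → Ω → ℝ}
    (hu : ∀ i, Measurable (u i)) (hi : iIndepFun u P) {a : ι} {s : Finset ι} (ha : a ∉ s)
    (c d : Finset ι → ℝ) {G : ℝ → ℝ} (hG : Measurable G) :
    IndepFun (fun ω => (tetra s c (fun i => u i ω), tetra s d (fun i => u i ω)))
      (fun ω => G (u a ω)) P := by
  have h := hi.indepFun_finset s {a} (by simpa using ha) hu
  have hext : ∀ (e : Finset ι → ℝ) (ω : Ω), tetra s e (fun i => u i ω)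
      = tetra s e (fun i => if hi : i ∈ s then (fun j : s => u j ω) ⟨i, hi⟩ else 0) := by
    intro e ω
    unfold tetra
    refine Finset.sum_congr rfl fun I hI => ?_
    congr 1
    refine Finset.prod_congr rfl fun i hi => ?_
    simp [Finset.mem_powerset.1 hI hi]
  have hm : ∀ e : Finset ι → ℝ, Measurable fun y : s → ℝ =>
      tetra s e (fun i => if hi : i ∈ s then y ⟨i, hi⟩ else 0) := by
    intro e
    unfold tetra
    refine Finset.measurable_fun_sum _ fun I _ =>
      (Finset.measurable_fun_prod _ fun i _ => ?_).smul_const _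
    by_cases hi : i ∈ s
    · simp only [hi, dite_true]
      exact measurable_pi_apply _
    · simp only [hi, dite_false]
      exact measurable_const
  have := h.comp ((hm c).prodMk (hm d))
    (hG.comp (measurable_pi_apply (⟨a, by simp⟩ : ({a} : Finset ι))))
  convert this using 1
  · funext ω
    simp only [Function.comp, hext c, hext d]
  · rfl

/-- Moment comparison for tetrahedral polynomials in independent bounded variables. -/
theorem integral_tetra_pow_four_le {ι : Type*} [DecidableEq ι] {u : ι → Ω → ℝ} {m : ι → ℝ}
    {v : ℝ} (hu : ∀ i, Measurable (u i)) (hb : ∀ i ω, |u i ω| ≤ 1) (hi : iIndepFun u P)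
    (hm : ∀ i, ∫ ω, u i ω ∂P = m i) (hv : ∀ i, v ≤ ∫ ω, (u i ω - m i) ^ 2 ∂P) {R : ℝ}
    (hR : 4 ≤ R) (hRv : 12 ≤ R ^ 2 * v) (s : Finset ι) :
    ∀ (k : ℕ) (c : Finset ι → ℝ), (∀ I, k < I.card → c I = 0) →
      ∫ ω, tetra s c (fun i => u i ω) ^ 4 ∂P
        ≤ (R ^ 2) ^ k * (∫ ω, tetra s c (fun i => u i ω) ^ 2 ∂P) ^ 2 := by
  have hub : ∀ i, BddMeasurable (u i) := fun i => ⟨hu i, 1, hb i⟩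
  induction s using Finset.induction_on with
  | empty =>
    intro k c _
    simp only [tetra, Finset.powerset_empty, Finset.sum_singleton, Finset.prod_empty, one_smul,
      integral_const, probReal_univ, ← pow_mul]
    norm_num
    have : 1 ≤ (R ^ 2) ^ k := one_le_pow₀ (by nlinarith)
    rw [← pow_mul] at this
    nlinarith [pow_nonneg (sq_nonneg (c ∅)) 2]
  | insert a s ha ih =>
    intro k c hc
    rcases k with _ | k
    · simp only [tetra_eq_const _ hc, integral_const, probReal_univ, one_smul, ← pow_mul]
      norm_num
    -- `d` is set to zero on sets containing `a`: there `insert a I = I`, so `c (insert a I)` need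
    -- not vanish when `I` has `k + 1` elements. Subsets of `s` do not see the change.
    · set d : Finset ι → ℝ := fun I => if a ∈ I then 0 else c (insert a I) with hd
      have hcd : ∀ x, tetra s (fun I => c (insert a I)) x = tetra s d x := by
        intro x
        unfold tetra
        refine Finset.sum_congr rfl fun I hI => ?_
        simp [hd, show a ∉ I from fun h => ha (Finset.mem_powerset.1 hI h)]
      have hd0 : ∀ I, k < I.card → d I = 0 := by
        intro I hI
        by_cases haI : a ∈ I
        · simp [hd, haI]
        · simp only [hd, haI, if_false]
          exact hc _ (by rw [Finset.card_insert_of_notMem haI]; omega)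
      -- Centring `u a` moves `m a • d` into the part free of `u a`, without raising its degree.
      have hdec : ∀ ω, tetra (insert a s) c (fun i => u i ω)
          = tetra s (c + m a • d) (fun i => u i ω)
            + (u a ω - m a) * tetra s d (fun i => u i ω) := by
        intro ω
        rw [tetra_insert ha, hcd, tetra_add, tetra_smul]
        simp only [smul_eq_mul]
        ring
      simp only [hdec]
      have hma : |m a| ≤ 1 := by
        rw [← hm a]
        simpa using norm_integral_le_of_norm_le_const (μ := P) (f := u a) (C := 1) (ae_of_all _ (hb a))
      have := integral_pow_four_add_mul_le (P := P)
        (f := fun ω => tetra s (c + m a • d) fun i => u i ω)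
        (g := fun ω => tetra s d fun i => u i ω) (w := fun ω => u a ω - m a)
        (indepFun_tetra_pair hu hi ha _ _ (G := fun z => z - m a) (by fun_prop))
        (BddMeasurable.tetra s _ hub) (BddMeasurable.tetra s _ hub) ((hu a).sub_const _)
        (fun ω => (abs_sub _ _).trans (by linarith [hb a ω]))
        (by rw [integral_sub (hub a).integrable (integrable_const _), hm a]; simp)
        hR hRv (hv a) (D := (R ^ 2) ^ k) (by positivity) ?_ (ih k d hd0)
      · rwa [pow_succ']
      · rw [← pow_succ']
        refine ih (k + 1) _ fun I hI => ?_
        simp [hc I hI, hd0 I (by omega)]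

/-- Each monomial is a product of distinct independent variables, so expectation acts by replacing
every variable by its mean. -/
lemma integral_tetra {ι : Type*} {u : ι → Ω → ℝ} {m : ι → ℝ} (hu : ∀ i, Measurable (u i))
    (hb : ∀ i ω, |u i ω| ≤ 1) (hi : iIndepFun u P) (hm : ∀ i, ∫ ω, u i ω ∂P = m i)
    (s : Finset ι) (c : Finset ι → ℝ) :
    ∫ ω, tetra s c (fun i => u i ω) ∂P = tetra s c m := by
  have hub : ∀ i, BddMeasurable (u i) := fun i => ⟨hu i, 1, hb i⟩
  simp only [tetra, smul_eq_mul]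
  rw [integral_finsetSum _ fun I _ =>
    ((BddMeasurable.prod I fun i _ => hub i).mul (.const _)).integrable]
  refine Finset.sum_congr rfl fun I _ => ?_
  rw [integral_mul_const]
  congr 1
  have h := (hi.precomp (g := ((↑) : I → ι)) Subtype.val_injective).integral_fun_prod_eq_prod_integral
    (fun i => (hu i).aestronglyMeasurable)
  simp only [← Finset.prod_coe_sort I, ← hm]
  exact h

/-- A Paley–Zygmund type inequality. -/
lemma measureReal_half_abs_integral_le {p : Ω → ℝ} (hp : BddMeasurable p) {C : ℝ} (hC : 1 ≤ C)
    (h4 : ∫ ω, p ω ^ 4 ∂P ≤ C * (∫ ω, p ω ^ 2 ∂P) ^ 2) :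
    1 / (2 * C) ≤ P.real {ω | |∫ ω, p ω ∂P| / 2 ≤ |p ω|} := by
  set M := ∫ ω, p ω ∂P
  set S := ∫ ω, p ω ^ 2 ∂P
  set T : Set Ω := {ω | |M| / 2 ≤ |p ω|}
  have hT : MeasurableSet T := measurableSet_le measurable_const (by have := hp.1; fun_prop)
  have hMS : M ^ 2 ≤ S := by
    simpa using sq_integral_mul_le (P := P) hp (.const 1)
  set q : Ω → ℝ := T.indicator 1
  have hq : BddMeasurable q := by
    refine ⟨measurable_one.indicator hT, 1, fun ω => ?_⟩
    by_cases h : ω ∈ T <;> simp [q, h]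
  have hqi : ∫ ω, q ω ∂P = P.real T := integral_indicator_one hT
  have hq2 : ∀ ω, q ω ^ 2 = q ω := fun ω => by by_cases h : ω ∈ T <;> simp [q, h]
  rcases eq_or_ne M 0 with h0 | h0
  · have : T = Set.univ := by
      ext ω
      simp [T, h0]
    rw [this, probReal_univ, div_le_one (by positivity)]
    linarith
  have hS : 0 < S := lt_of_lt_of_le (by positivity) hMS
  have hcs := sq_integral_mul_le (P := P) (hp.pow 2) hq
  simp only [hq2, hqi, ← pow_mul] at hcs
  -- Off `T` one has `p² ≤ M² / 4 ≤ S / 4`, so at least three quarters of the second moment lives on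
  -- `T`. Cauchy–Schwarz against the indicator of `T` then gives `9 / 16 ≤ C * P(T)`.
  have hlow : 3 / 4 * S ≤ ∫ ω, p ω ^ 2 * q ω ∂P := by
    have hpt : ∀ ω, p ω ^ 2 ≤ M ^ 2 / 4 + p ω ^ 2 * q ω := by
      intro ω
      by_cases h : ω ∈ T
      · simp only [q, h, Set.indicator_of_mem, Pi.one_apply]
        nlinarith [sq_nonneg M]
      · have h' : |p ω| < |M| / 2 := not_le.1 h
        simp only [q, h, not_false_eq_true, Set.indicator_of_notMem, mul_zero, add_zero]
        rw [← sq_abs (p ω), ← sq_abs M]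
        nlinarith [abs_nonneg (p ω)]
    have := integral_mono (μ := P) (hp.pow 2).integrable
      ((integrable_const (M ^ 2 / 4)).add ((hp.pow 2).mul hq).integrable) hpt
    simp only [Pi.add_apply] at this
    rw [integral_add (integrable_const _) ((hp.pow 2).mul hq).integrable] at this
    simp only [integral_const, probReal_univ, one_smul] at this
    linarith
  have hsq : (3 / 4 * S) ^ 2 ≤ C * S ^ 2 * P.real T :=
    (pow_le_pow_left₀ (by positivity) hlow 2).trans
      (hcs.trans (mul_le_mul_of_nonneg_right h4 measureReal_nonneg))
  have : 9 / 16 ≤ C * P.real T := by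
    have h2 : S ^ 2 * (9 / 16) ≤ S ^ 2 * (C * P.real T) := by nlinarith
    exact le_of_mul_le_mul_left h2 (by positivity)
  rw [div_le_iff₀ (by positivity)]
  nlinarith

/-- Anticoncentration of vector valued tetrahedral polynomials in independent bounded variables
with variances bounded from below. -/
theorem exists_anticoncentration (k : ℕ) {v : ℝ} (hv : 0 < v) :
    ∃ c : ℝ, 0 < c ∧ ∀ {Ω : Type} [MeasurableSpace Ω] {P : Measure Ω} [IsProbabilityMeasure P]
      {ι : Type} {E : Type*} [NormedAddCommGroup E] [NormedSpace ℝ E] {u : ι → Ω → ℝ}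
      {m : ι → ℝ}, (∀ i, Measurable (u i)) → (∀ i ω, |u i ω| ≤ 1) → iIndepFun u P →
      (∀ i, ∫ ω, u i ω ∂P = m i) → (∀ i, v ≤ ∫ ω, (u i ω - m i) ^ 2 ∂P) →
      ∀ (s : Finset ι) (C : Finset ι → E), (∀ I, I.card ≠ k → C I = 0) → ∀ y : ι → ℝ,
        c ≤ P.real {ω | ‖tetra s C (m * y)‖ / 2 ≤ ‖tetra s C ((fun i => u i ω) * y)‖} := by
  classical
  -- Chosen so that both `R ≥ 4` and `R ^ 2 * v ≥ 12` hold for every `v > 0`.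
  set R : ℝ := 4 + 12 / v
  have hR : 4 ≤ R := by simp only [R]; linarith [show 0 < 12 / v by positivity]
  have hRv : 12 ≤ R ^ 2 * v := by
    have h1 : R * v = 4 * v + 12 := by simp only [R]; field_simp
    nlinarith [mul_pos hv (by linarith : 0 < R)]
  refine ⟨1 / (2 * (R ^ 2) ^ k), by positivity, ?_⟩
  intro Ω _ P _ ι E _ _ u m hu hb hi hm hvar s C hC y
  -- `φ` attains the norm at the mean value `T(m y)` and can only decrease it elsewhere; this makes
  -- the constant independent of the Banach space.
  obtain ⟨φ, hφ, hφx⟩ := exists_dual_vector'' ℝ (tetra s C (m * y))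
  set d : Finset ι → ℝ := fun I => φ ((∏ i ∈ I, y i) • C I)
  have hd : ∀ x, φ (tetra s C (x * y)) = tetra s d x := fun x => by
    rw [tetra_mul, map_tetra]
  have h4 := integral_tetra_pow_four_le hu hb hi hm hvar hR hRv s k d
    (fun I hI => by simp [d, hC I (by omega)])
  have := measureReal_half_abs_integral_le
    (BddMeasurable.tetra s d fun i => ⟨hu i, 1, hb i⟩) (one_le_pow₀ (by nlinarith)) h4
  refine this.trans (measureReal_mono fun ω hω => ?_)
  simp only [Set.mem_ofPred_eq] at hω ⊢
  rw [integral_tetra hu hb hi hm, ← hd, ← hd, hφx] at hω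
  simp only [RCLike.ofReal_real_eq_id, id, abs_norm] at hω
  refine hω.trans ((φ.le_opNorm _).trans ?_)
  exact mul_le_of_le_one_left (norm_nonneg _) hφ

end Moments

/-! ### Quantile coupling on the unit interval. -/

section Quantile

open Set Filter Topology

/-- The quantile function of a probability measure on the line, set to `0` outside `(0, 1)`. -/
noncomputable def quantileFun (m : Measure ℝ) (u : ℝ) : ℝ :=
  open Classical in if u ∈ Ioo (0 : ℝ) 1 then sSup {t | cdf m t < u} else 0

/-- Right continuity of the distribution function is what makes the equivalence hold with strict
inequalities on both sides. -/
lemma lt_quantileFun_iff (m : Measure ℝ) {u : ℝ} (hu : u ∈ Ioo (0 : ℝ) 1)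
    (t : ℝ) : t < quantileFun m u ↔ cdf m t < u := by
  rw [quantileFun, if_pos hu]
  have hne : {t | cdf m t < u}.Nonempty :=
    ((tendsto_cdf_atBot m).eventually (gt_mem_nhds hu.1)).exists
  have hbd : BddAbove {t | cdf m t < u} := by
    obtain ⟨b, hb⟩ := ((tendsto_cdf_atTop m).eventually (lt_mem_nhds hu.2)).exists
    exact ⟨b, fun s hs => le_of_not_gt fun h => absurd (monotone_cdf m h.le)
      (not_le.2 (lt_trans hs hb))⟩
  constructor
  · intro h
    obtain ⟨s, hs, hts⟩ := exists_lt_of_lt_csSup hne h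
    exact (monotone_cdf m hts.le).trans_lt hs
  · intro h
    have hc : Tendsto (cdf m) (𝓝[>] t) (𝓝 (cdf m t)) :=
      ((cdf m).right_continuous t).mono_left (nhdsWithin_mono _ Ioi_subset_Ici_self)
    obtain ⟨s, hs, hts⟩ := ((hc.eventually (gt_mem_nhds h)).and self_mem_nhdsWithin).exists
    exact lt_of_lt_of_le hts (le_csSup hbd hs)

lemma measurable_quantileFun (m : Measure ℝ) : Measurable (quantileFun m) := by
  refine measurable_of_Ioi fun t => ?_
  have : quantileFun m ⁻¹' Ioi t
      = (Ioo 0 1 ∩ Ioi (cdf m t)) ∪ ((Ioo (0 : ℝ) 1)ᶜ ∩ {_u | t < 0}) := by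
    ext u
    by_cases hu : u ∈ Ioo (0 : ℝ) 1
    · have h := lt_quantileFun_iff m hu t
      simp only [mem_preimage, mem_Ioi, mem_union, mem_inter_iff, mem_compl_iff, hu, true_and,
        not_true, false_and, or_false, h]
    · simp only [mem_preimage, mem_Ioi, mem_union, mem_inter_iff, mem_compl_iff, hu, false_and,
        not_false_eq_true, true_and, false_or, quantileFun, if_false, mem_ofPred_eq]
  rw [this]
  exact (measurableSet_Ioo.inter measurableSet_Ioi).union
    (measurableSet_Ioo.compl.inter (MeasurableSet.const _))

instance : IsProbabilityMeasure (volume.restrict (Ioo (0 : ℝ) 1)) := ⟨by simp⟩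

lemma map_quantileFun (m : Measure ℝ) [IsProbabilityMeasure m] :
    (volume.restrict (Ioo (0 : ℝ) 1)).map (quantileFun m) = m := by
  have := Measure.isProbabilityMeasure_map
    (μ := volume.restrict (Ioo (0 : ℝ) 1)) (measurable_quantileFun m).aemeasurable
  refine Measure.ext_of_Iic _ _ fun t => ?_
  rw [Measure.map_apply (measurable_quantileFun m) measurableSet_Iic,
    Measure.restrict_apply (measurable_quantileFun m measurableSet_Iic)]
  have h1 : quantileFun m ⁻¹' Iic t ∩ Ioo 0 1 = Ioo 0 1 ∩ Iic (cdf m t) := by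
    ext u
    by_cases hu : u ∈ Ioo (0 : ℝ) 1
    · have h := (lt_quantileFun_iff m hu t).not
      simp only [not_lt] at h
      simp only [mem_inter_iff, mem_preimage, mem_Iic, hu, and_true, true_and, h]
    · simp only [mem_inter_iff, hu, and_false, false_and]
  have h2 : volume (Ioo 0 1 ∩ Iic (cdf m t)) = ENNReal.ofReal (cdf m t) := by
    refine le_antisymm ?_ ?_
    · refine (measure_mono (t := Ioc 0 (cdf m t)) fun u hu => ⟨hu.1.1, hu.2⟩).trans ?_
      simp
    · have : Ioo 0 (cdf m t) ⊆ Ioo 0 1 ∩ Iic (cdf m t) :=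
        fun u hu => ⟨⟨hu.1, hu.2.trans_le (cdf_le_one m t)⟩, hu.2.le⟩
      simpa using measure_mono (μ := volume) this
  rw [h1, h2, ofReal_cdf]

lemma quantileFun_le_quantileFun {m n : Measure ℝ} (h : ∀ t, cdf n t ≤ cdf m t) (u : ℝ) :
    quantileFun m u ≤ quantileFun n u := by
  by_cases hu : u ∈ Ioo (0 : ℝ) 1
  · refine le_of_forall_lt fun t ht => ?_
    rw [lt_quantileFun_iff _ hu] at ht ⊢
    exact (h t).trans_lt ht
  · simp [quantileFun, hu]

/-- The hypothesis concerns `t > 0` only: at zero the bound follows by right continuity, and below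
zero both sides vanish. -/
lemma cdf_map_abs_le {m n : Measure ℝ} [IsProbabilityMeasure m] [IsProbabilityMeasure n]
    (h : ∀ t, 0 < t → m {x | t < |x|} ≤ n {x | t < |x|}) (t : ℝ) :
    cdf (n.map abs) t ≤ cdf (m.map abs) t := by
  have hp : ∀ m : Measure ℝ, [IsProbabilityMeasure m] → IsProbabilityMeasure (m.map abs) :=
    fun m _ => Measure.isProbabilityMeasure_map measurable_abs.aemeasurable
  have := hp m
  have := hp n
  have hpos : ∀ t, 0 < t → cdf (n.map abs) t ≤ cdf (m.map abs) t := by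
    intro t ht
    have e : ∀ m : Measure ℝ, [IsProbabilityMeasure m] →
        cdf (m.map abs) t = 1 - m.real {x | t < |x|} := by
      intro m _
      have := hp m
      rw [cdf_eq_real, map_measureReal_apply measurable_abs measurableSet_Iic,
        ← probReal_compl_eq_one_sub (measurableSet_lt measurable_const measurable_abs)]
      congr 1
      ext x
      simp
    rw [e m, e n]
    have := ENNReal.toReal_mono (measure_ne_top _ _) (h t ht)
    simp only [measureReal_def]
    linarith
  have hz : ∀ m : Measure ℝ, [IsProbabilityMeasure m] → t < 0 → cdf (m.map abs) t = 0 := by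
    intro m _ ht
    have := hp m
    rw [cdf_eq_real, map_measureReal_apply measurable_abs measurableSet_Iic]
    have : abs ⁻¹' Iic t = (∅ : Set ℝ) := by
      ext x
      simpa using ht.trans_le (abs_nonneg x)
    simp [this]
  rcases lt_trichotomy t 0 with ht | rfl | ht
  · rw [hz m ht, hz n ht]
  · have hc : ∀ m : Measure ℝ, Tendsto (cdf m) (𝓝[>] 0) (𝓝 (cdf m 0)) := fun m =>
      ((cdf m).right_continuous 0).mono_left (nhdsWithin_mono _ Ioi_subset_Ici_self)
    exact le_of_tendsto_of_tendsto (hc _) (hc _)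
      (eventually_nhdsWithin_of_forall fun t ht => hpos t ht)
  · exact hpos t ht

end Quantile

/-! ### Anticoncentration for two-valued variables. -/

/-- The Bernoulli law with parameter `p`. -/
noncomputable def bern (p : unitInterval) : Measure Bool :=
  ENNReal.ofReal p • Measure.dirac true + ENNReal.ofReal (1 - p) • Measure.dirac false

instance (p : unitInterval) : IsProbabilityMeasure (bern p) := by
  refine ⟨?_⟩
  simp only [bern, Measure.add_apply, Measure.smul_apply, measure_univ, smul_eq_mul, mul_one]
  rw [← ENNReal.ofReal_add p.2.1 (by linarith [p.2.2])]
  simp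

lemma integral_bern (p : unitInterval) (g : Bool → ℝ) :
    ∫ b, g b ∂(bern p) = p * g true + (1 - p) * g false := by
  have h1 : (0 : ℝ) ≤ p := p.2.1
  have h2 : (0 : ℝ) ≤ 1 - p := by linarith [p.2.2]
  rw [bern, integral_add_measure (Integrable.of_finite.smul_measure ENNReal.ofReal_ne_top)
    (Integrable.of_finite.smul_measure ENNReal.ofReal_ne_top), integral_smul_measure,
    integral_smul_measure, integral_dirac, integral_dirac, ENNReal.toReal_ofReal h1,
    ENNReal.toReal_ofReal h2, smul_eq_mul, smul_eq_mul]

/-- The Rademacher cube law on `ι → Bool`. -/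
noncomputable def fairCube (ι : Type*) [Fintype ι] : Measure (ι → Bool) :=
  Measure.pi fun _ => bern ⟨1 / 2, by norm_num, by norm_num⟩

instance (ι : Type*) [Fintype ι] : IsProbabilityMeasure (fairCube ι) := by
  unfold fairCube
  infer_instance

/-- The sign `±1` attached to a Boolean. -/
def boolSign (b : Bool) : ℝ := if b then 1 else -1

/-- Covers both uses: `g = boolSign` for contraction and `g = boolInd` for thinning. The lower bound
assumed on `q i * (1 - q i) * (g true - g false) ^ 2` is the variance bound. -/
lemma exists_anticoncentration_bern (k : ℕ) {v : ℝ} (hv : 0 < v) :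
    ∃ c : ENNReal, c ≠ 0 ∧ ∀ {ι : Type} [Fintype ι] {E : Type*} [NormedAddCommGroup E]
      [NormedSpace ℝ E] (q : ι → unitInterval) (g : Bool → ℝ), (∀ b, |g b| ≤ 1) →
      (∀ i, v ≤ q i * (1 - q i) * (g true - g false) ^ 2) →
      ∀ C : Finset ι → E, (∀ I, I.card ≠ k → C I = 0) → ∀ y : ι → ℝ,
        c ≤ (Measure.pi fun i => bern (q i))
          {b | ‖tetra Finset.univ C ((fun i => q i * g true + (1 - q i) * g false) * y)‖ / 2
            ≤ ‖tetra Finset.univ C ((fun i => g (b i)) * y)‖} := by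
  obtain ⟨c, hc, h⟩ := exists_anticoncentration k hv
  refine ⟨ENNReal.ofReal c, by simpa using hc, ?_⟩
  intro ι _ E _ _ q g hg hq C hC y
  have hev : ∀ (i : ι) (G : Bool → ℝ), ∫ b, G (b i) ∂(Measure.pi fun i => bern (q i))
      = q i * G true + (1 - q i) * G false := by
    intro i G
    rw [← integral_bern, integral_comp_eval (μ := fun i => bern (q i)) (i := i)]
    exact Measurable.of_discrete.aestronglyMeasurable
  have := h (P := Measure.pi fun i => bern (q i)) (u := fun i b => g (b i))
    (fun i => Measurable.of_discrete) (fun i b => hg _)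
    (iIndepFun_pi (X := fun _ => g) fun i => Measurable.of_discrete.aemeasurable)
    (fun i => hev i g) (fun i => ?_) Finset.univ C hC y
  · rwa [← ofReal_measureReal, ENNReal.ofReal_le_ofReal_iff measureReal_nonneg]
  · rw [hev i (fun b => (g b - (q i * g true + (1 - q i) * g false)) ^ 2)]
    refine (hq i).trans (le_of_eq ?_)
    ring

lemma mul_measure_le_prod {X Y : Type*} [MeasurableSpace X] [MeasurableSpace Y] (μ : Measure X)
    (κ : Measure Y) [SFinite κ] {c : ENNReal} {S : Set X} (hS : MeasurableSet S)
    {T : Set (X × Y)} (hT : MeasurableSet T) (h : ∀ x ∈ S, c ≤ κ (Prod.mk x ⁻¹' T)) :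
    c * μ S ≤ μ.prod κ T := by
  rw [Measure.prod_apply hT, ← lintegral_indicator_const hS]
  refine lintegral_mono fun x => ?_
  by_cases hx : x ∈ S
  · simpa [hx] using h x hx
  · simp [hx]

/-! ### Rademacher chaos and the contraction principle. -/

section Signs

variable {ι : Type*} [Fintype ι]

lemma boolSign_mul (a b : Bool) : boolSign a * boolSign b = boolSign (a == b) := by
  cases a <;> cases b <;> simp [boolSign]

/-- Multiplying by fixed signs `u` acts on Booleans as `ε ↦ (u == ε)`, which preserves the fair cube
law. -/
lemma fairCube_sign_invariant (S : Set (ι → ℝ)) (u : ι → Bool) (x : ι → ℝ) :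
    fairCube ι {ε | (fun i => boolSign (u i)) * ((fun i => boolSign (ε i)) * x) ∈ S}
      = fairCube ι {ε | (fun i => boolSign (ε i)) * x ∈ S} := by
  have h1 : ∀ b : Bool, MeasurePreserving (fun a => b == a)
      (bern ⟨1 / 2, by norm_num, by norm_num⟩) (bern ⟨1 / 2, by norm_num, by norm_num⟩) := by
    intro b
    refine ⟨Measurable.of_discrete, ?_⟩
    unfold bern
    rw [Measure.map_add _ _ Measurable.of_discrete, Measure.map_smul, Measure.map_smul,
      Measure.map_dirac' Measurable.of_discrete, Measure.map_dirac' Measurable.of_discrete]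
    cases b
    · simp only [show (1 : ℝ) - 1 / 2 = 1 / 2 by norm_num]
      exact add_comm _ _
    · rfl
  have h2 : MeasurePreserving (fun (ε : ι → Bool) i => u i == ε i) (fairCube ι) (fairCube ι) :=
    measurePreserving_pi _ _ fun i => h1 (u i)
  rw [← h2.measure_preimage (s := {ε | (fun i => boolSign (ε i)) * x ∈ S})
    MeasurableSet.of_discrete.nullMeasurableSet]
  congr 1
  ext ε
  simp only [Set.mem_ofPred_eq, Set.mem_preimage, ← mul_assoc]
  rw [show ((fun i => boolSign (u i)) * fun i => boolSign (ε i))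
    = fun i => boolSign (u i == ε i) from funext fun i => boolSign_mul _ _]

lemma fairCube_abs (S : Set (ι → ℝ)) (x : ι → ℝ) :
    fairCube ι {ε | (fun i => boolSign (ε i)) * (fun i => |x i|) ∈ S}
      = fairCube ι {ε | (fun i => boolSign (ε i)) * x ∈ S} := by
  rw [← fairCube_sign_invariant S (fun i => decide (0 ≤ x i)) x]
  congr 1
  ext ε
  simp only [Set.mem_ofPred_eq]
  rw [show (fun i => boolSign (decide (0 ≤ x i))) * ((fun i => boolSign (ε i)) * x)
    = (fun i => boolSign (ε i)) * fun i => |x i| from ?_]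
  funext i
  simp only [Pi.mul_apply]
  rcases le_or_gt 0 (x i) with h | h
  · simp [boolSign, h, abs_of_nonneg h]
  · by_cases hε : ε i <;> simp [boolSign, not_le.2 h, abs_of_neg h, hε]

end Signs

/-- Contraction principle for Rademacher chaos. -/
theorem exists_contraction (k : ℕ) : ∃ c : ENNReal, c ≠ 0 ∧ ∀ {ι : Type} [Fintype ι] {E : Type*}
    [NormedAddCommGroup E] [NormedSpace ℝ E] (C : Finset ι → E), (∀ I, I.card ≠ k → C I = 0) →
    ∀ a b : ι → ℝ, (∀ i, |b i| ≤ |a i|) → ∀ t : ℝ,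
      c * fairCube ι {ε | t < ‖tetra Finset.univ C ((fun i => boolSign (ε i)) * b)‖}
        ≤ fairCube ι
          {ε | t / 2 ^ (k + 1) < ‖tetra Finset.univ C ((fun i => boolSign (ε i)) * a)‖} := by
  obtain ⟨c, hc, h⟩ := exists_anticoncentration_bern k (v := 3 / 4) (by norm_num)
  refine ⟨c, hc, ?_⟩
  intro ι _ E _ _ C hC a b hab t
  -- Where `a i = 0`, division by zero gives `θ i = 0`, consistent with `b i = 0`.
  set θ : ι → ℝ := fun i => b i / a i with hθ
  have hθ1 : ∀ i, |θ i| ≤ 1 := fun i => by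
    rw [hθ, abs_div]
    exact div_le_one_of_le₀ (hab i) (abs_nonneg _)
  have hb : b = θ * a := by
    funext i
    simp only [hθ, Pi.mul_apply]
    by_cases ha : a i = 0
    · have := hab i
      rw [ha, abs_zero] at this
      rw [ha, mul_zero]
      exact abs_nonpos_iff.1 this
    · field_simp
  -- A sign that is positive with this probability has mean `θ i / 2`. The halving keeps the
  -- variance `1 - θ i ^ 2 / 4` at least `3 / 4`; by homogeneity it costs `2 ^ k`, and
  -- anticoncentration costs one more factor 2.
  set q : ι → unitInterval := fun i => ⟨1 / 2 + θ i / 4, by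
    have := abs_le.1 (hθ1 i); constructor <;> linarith⟩ with hq
  set S : Set (ι → ℝ) := {x | t / 2 ^ (k + 1) < ‖tetra Finset.univ C x‖}
  set T : Set ((ι → Bool) × (ι → Bool)) :=
    {z | (fun i => boolSign (z.2 i)) * ((fun i => boolSign (z.1 i)) * a) ∈ S}
  have hT : MeasurableSet T := .of_discrete
  have key := mul_measure_le_prod (fairCube ι) (Measure.pi fun i => bern (q i)) (c := c)
    (S := {ε | t < ‖tetra Finset.univ C ((fun i => boolSign (ε i)) * b)‖}) .of_discrete hT ?_
  · refine key.trans_eq ?_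
    rw [Measure.prod_apply_symm hT]
    -- Integrating in the other order, each fixed `u` is absorbed by the fair signs, so the biased
    -- signs disappear.
    have : ∀ u : ι → Bool, fairCube ι ((fun ε => (ε, u)) ⁻¹' T)
        = fairCube ι {ε | (fun i => boolSign (ε i)) * a ∈ S} :=
      fun u => fairCube_sign_invariant S u a
    simp [this, S]
  · intro ε hε
    refine (h q boolSign (fun b => by cases b <;> simp [boolSign]) (fun i => ?_) C hC
      ((fun i => boolSign (ε i)) * a)).trans (measure_mono fun u hu => ?_)
    · have := abs_le.1 (hθ1 i)
      simp only [hq, boolSign, if_true, Bool.false_eq_true, if_false]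
      nlinarith
    · simp only [Set.mem_ofPred_eq] at hu hε
      have e : (fun i => (q i : ℝ) * boolSign true + (1 - q i) * boolSign false)
          * ((fun i => boolSign (ε i)) * a) = (1 / 2 : ℝ) • ((fun i => boolSign (ε i)) * b) := by
        funext i
        simp only [hb, hq, boolSign, Pi.mul_apply, Pi.smul_apply, smul_eq_mul, if_true,
          Bool.false_eq_true, if_false]
        ring
      rw [e, tetra_smul_arg _ hC, norm_smul, Real.norm_of_nonneg (by positivity)] at hu
      refine lt_of_lt_of_le ?_ hu
      rw [div_pow, one_pow, pow_succ]
      have : (0 : ℝ) < 1 / 2 ^ k := by positivity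
      calc t / (2 ^ k * 2) = 1 / 2 ^ k * t / 2 := by field_simp
        _ < _ := by gcongr

/-! ### Comparison under tail domination with constant one. -/

section Comparison

variable {ι : Type*} [Fintype ι]

lemma measurable_norm_tetra {E : Type*} [NormedAddCommGroup E] [NormedSpace ℝ E] (s : Finset ι)
    (C : Finset ι → E) : Measurable fun x => ‖tetra s C x‖ := by
  have := (continuous_tetra s C).norm
  exact this.measurable

omit [Fintype ι] in
lemma measurable_bool_mul (g : Bool → ℝ) :
    Measurable fun z : (ι → ℝ) × (ι → Bool) => (fun i => g (z.2 i)) * z.1 := by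
  refine measurable_pi_lambda _ fun i => ?_
  have h : Measurable fun z : (ι → ℝ) × (ι → Bool) => g (z.2 i) :=
    (Measurable.of_discrete (f := g)).comp (by fun_prop)
  exact h.mul (by fun_prop)

/-- A product of symmetric laws is a mixture of sign-randomised points. -/
lemma pi_eq_lintegral_fairCube {μ : ι → Measure ℝ} [∀ i, IsProbabilityMeasure (μ i)]
    (hμ : ∀ i, (μ i).map (fun x => -x) = μ i) {S : Set (ι → ℝ)} (hS : MeasurableSet S) :
    Measure.pi μ S
      = ∫⁻ x, fairCube ι {ε | (fun i => boolSign (ε i)) * x ∈ S} ∂(Measure.pi μ) := by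
  set T : Set ((ι → ℝ) × (ι → Bool)) := (fun z => (fun i => boolSign (z.2 i)) * z.1) ⁻¹' S
  have hT : MeasurableSet T := measurable_bool_mul boolSign hS
  have h1 := Measure.prod_apply (μ := Measure.pi μ) (ν := fairCube ι) hT
  have h2 := Measure.prod_apply_symm (μ := Measure.pi μ) (ν := fairCube ι) hT
  have h3 : ∀ ε : ι → Bool, Measure.pi μ ((fun x => (x, ε)) ⁻¹' T) = Measure.pi μ S := by
    intro ε
    have : MeasurePreserving (fun (x : ι → ℝ) i => boolSign (ε i) * x i) (Measure.pi μ)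
        (Measure.pi μ) := by
      refine measurePreserving_pi _ _ fun i => ⟨by fun_prop, ?_⟩
      cases ε i
      · rw [show HMul.hMul (boolSign false) = fun x : ℝ => -x by funext x; simp [boolSign]]
        exact hμ i
      · rw [show HMul.hMul (boolSign true) = (id : ℝ → ℝ) by funext x; simp [boolSign]]
        exact Measure.map_id
    exact this.measure_preimage hS.nullMeasurableSet
  rw [h2] at h1
  simp only [h3, lintegral_const, measure_univ, mul_one] at h1
  exact h1

lemma lintegral_pi_comp_abs {μ : ι → Measure ℝ} [∀ i, IsProbabilityMeasure (μ i)]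
    {F : (ι → ℝ) → ENNReal} (hF : Measurable F) :
    ∫⁻ x, F (fun i => |x i|) ∂(Measure.pi μ)
      = ∫⁻ u, F (fun i => quantileFun ((μ i).map abs) (u i))
          ∂(Measure.pi fun _ => volume.restrict (Set.Ioo (0 : ℝ) 1)) := by
  have : ∀ i, IsProbabilityMeasure ((μ i).map abs) := fun i =>
    Measure.isProbabilityMeasure_map measurable_abs.aemeasurable
  have h1 : MeasurePreserving (fun (x : ι → ℝ) i => |x i|) (Measure.pi μ)
      (Measure.pi fun i => (μ i).map abs) :=
    measurePreserving_pi _ _ fun i => ⟨measurable_abs, rfl⟩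
  have h2 : MeasurePreserving (fun (u : ι → ℝ) i => quantileFun ((μ i).map abs) (u i))
      (Measure.pi fun _ => volume.restrict (Set.Ioo (0 : ℝ) 1))
      (Measure.pi fun i => (μ i).map abs) :=
    measurePreserving_pi _ _ fun i => ⟨measurable_quantileFun _, map_quantileFun _⟩
  rw [h1.lintegral_comp hF, h2.lintegral_comp hF]

end Comparison

/-- Comparison of chaoses in symmetric variables under tail domination with constant one. -/
theorem exists_comparison (k : ℕ) : ∃ c : ENNReal, c ≠ 0 ∧ ∀ {ι : Type} [Fintype ι] {E : Type*}
    [NormedAddCommGroup E] [NormedSpace ℝ E] (C : Finset ι → E), (∀ I, I.card ≠ k → C I = 0) →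
    ∀ (μ ν : ι → Measure ℝ) [∀ i, IsProbabilityMeasure (μ i)] [∀ i, IsProbabilityMeasure (ν i)],
      (∀ i, (μ i).map (fun x => -x) = μ i) → (∀ i, (ν i).map (fun x => -x) = ν i) →
      (∀ i t, 0 < t → μ i {x | t < |x|} ≤ ν i {x | t < |x|}) → ∀ t : ℝ,
      c * Measure.pi μ {x | t < ‖tetra Finset.univ C x‖}
        ≤ Measure.pi ν {x | t / 2 ^ (k + 1) < ‖tetra Finset.univ C x‖} := by
  obtain ⟨c, hc, h⟩ := exists_contraction k
  refine ⟨c, hc, ?_⟩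
  intro ι _ E _ _ C hC μ ν _ _ hμ hν hμν t
  have hS : ∀ r : ℝ, MeasurableSet {x : ι → ℝ | r < ‖tetra Finset.univ C x‖} := fun r =>
    measurableSet_lt measurable_const (measurable_norm_tetra _ C)
  -- The probability over the fair signs with `x` held fixed; it depends only on the moduli `|x i|`.
  set F : ℝ → (ι → ℝ) → ENNReal := fun r x =>
    fairCube ι {ε | (fun i => boolSign (ε i)) * x ∈ {x | r < ‖tetra Finset.univ C x‖}}
  have hF : ∀ r, Measurable (F r) := fun r =>
    measurable_measure_prodMk_left (measurable_bool_mul boolSign (hS r))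
  have habs : ∀ r x, F r (fun i => |x i|) = F r x := fun r x => fairCube_abs _ x
  have hrep : ∀ (m : ι → Measure ℝ) [∀ i, IsProbabilityMeasure (m i)],
      (∀ i, (m i).map (fun x => -x) = m i) → ∀ r,
      Measure.pi m {x | r < ‖tetra Finset.univ C x‖}
        = ∫⁻ u, F r (fun i => quantileFun ((m i).map abs) (u i))
          ∂(Measure.pi fun _ => volume.restrict (Set.Ioo (0 : ℝ) 1)) := by
    intro m _ hm r
    rw [← lintegral_pi_comp_abs (hF r), pi_eq_lintegral_fairCube hm (hS r)]
    simp only [habs]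
    rfl
  rw [hrep μ hμ, hrep ν hν, ← lintegral_const_mul]
  · refine lintegral_mono_ae ?_
    -- Contraction compares absolute values, so the ordering of the quantiles is usable only once
    -- they are known to be nonnegative.
    have hae : ∀ᵐ u ∂(Measure.pi fun _ : ι => volume.restrict (Set.Ioo (0 : ℝ) 1)),
        ∀ i, 0 ≤ quantileFun ((μ i).map abs) (u i) := by
      rw [ae_all_iff]
      intro i
      have : IsProbabilityMeasure ((μ i).map abs) :=
        Measure.isProbabilityMeasure_map measurable_abs.aemeasurable
      have h2 : MeasurePreserving (fun u : ι → ℝ => quantileFun ((μ i).map abs) (u i))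
          (Measure.pi fun _ => volume.restrict (Set.Ioo (0 : ℝ) 1)) ((μ i).map abs) :=
        MeasurePreserving.comp ⟨measurable_quantileFun _, map_quantileFun _⟩
          (measurePreserving_eval (fun _ : ι => volume.restrict (Set.Ioo (0 : ℝ) 1)) i)
      refine h2.quasiMeasurePreserving.ae (p := fun x => 0 ≤ x) ?_
      rw [ae_map_iff measurable_abs.aemeasurable measurableSet_Ici]
      exact ae_of_all _ fun x => abs_nonneg x
    filter_upwards [hae] with u hu
    refine h C hC _ _ (fun i => ?_) t
    have hle := quantileFun_le_quantileFun (fun s => cdf_map_abs_le (hμν i) s) (u i)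
    rw [abs_of_nonneg (hu i), abs_of_nonneg ((hu i).trans hle)]
    exact hle
  · exact (hF t).comp (measurable_pi_lambda _ fun i =>
      (measurable_quantileFun _).comp (measurable_pi_apply i))

/-! ### Thinning by independent Bernoulli variables. -/

/-- The `0`-`1` value of a Boolean. -/
def boolInd (b : Bool) : ℝ := if b then 1 else 0

/-- The law of `δ x`, where `x` has law `m` and `δ` is an independent Bernoulli variable. -/
noncomputable def thinning (p : unitInterval) (m : Measure ℝ) : Measure ℝ :=
  (m.prod (bern p)).map fun z => boolInd z.2 * z.1

lemma measurable_boolInd_mul : Measurable fun z : ℝ × Bool => boolInd z.2 * z.1 := by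
  have h : Measurable fun z : ℝ × Bool => boolInd z.2 :=
    (Measurable.of_discrete (f := boolInd)).comp (by fun_prop)
  exact h.mul (by fun_prop)

instance (p : unitInterval) (m : Measure ℝ) [IsProbabilityMeasure m] :
    IsProbabilityMeasure (thinning p m) :=
  Measure.isProbabilityMeasure_map measurable_boolInd_mul.aemeasurable

lemma thinning_map_neg (p : unitInterval) {m : Measure ℝ} [IsProbabilityMeasure m]
    (hm : m.map (fun x => -x) = m) : (thinning p m).map (fun x => -x) = thinning p m := by
  have h : MeasurePreserving (Prod.map (fun x : ℝ => -x) (id : Bool → Bool)) (m.prod (bern p))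
      (m.prod (bern p)) :=
    MeasurePreserving.prod ⟨measurable_neg, hm⟩ (.id _)
  unfold thinning
  rw [Measure.map_map measurable_neg measurable_boolInd_mul]
  nth_rewrite 2 [← h.map_eq]
  rw [Measure.map_map measurable_boolInd_mul h.measurable]
  congr 1
  funext z
  simp [Function.comp]

lemma thinning_tail (p : unitInterval) (m : Measure ℝ) [IsProbabilityMeasure m] {t : ℝ}
    (ht : 0 < t) :
    thinning p m {x | t < |x|} = ENNReal.ofReal p * m {x | t < |x|} := by
  have hS : MeasurableSet {x : ℝ | t < |x|} := measurableSet_lt measurable_const measurable_abs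
  rw [thinning, Measure.map_apply measurable_boolInd_mul hS]
  have : (fun z : ℝ × Bool => boolInd z.2 * z.1) ⁻¹' {x | t < |x|}
      = {x | t < |x|} ×ˢ {true} := by
    ext ⟨x, b⟩
    cases b <;> simp [boolInd, ht.le]
  rw [this, Measure.prod_prod, mul_comm]
  congr 1
  simp [bern]

/-- Thinning the variables decreases the tails of a chaos by at most a constant factor. -/
theorem exists_thinning_le (k : ℕ) (p : unitInterval) (hp0 : 0 < (p : ℝ)) (hp1 : (p : ℝ) < 1) :
    ∃ c : ENNReal, c ≠ 0 ∧ ∀ {ι : Type} [Fintype ι] {E : Type*}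
    [NormedAddCommGroup E] [NormedSpace ℝ E] (C : Finset ι → E), (∀ I, I.card ≠ k → C I = 0) →
    ∀ (μ : ι → Measure ℝ) [∀ i, IsProbabilityMeasure (μ i)], ∀ t : ℝ,
      c * Measure.pi μ {x | t < ‖tetra Finset.univ C x‖}
        ≤ Measure.pi (fun i => thinning p (μ i))
          {x | (p : ℝ) ^ k / 2 * t < ‖tetra Finset.univ C x‖} := by
  obtain ⟨c, hc, h⟩ := exists_anticoncentration_bern k (v := p * (1 - p))
    (mul_pos hp0 (by linarith))
  refine ⟨c, hc, ?_⟩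
  intro ι _ E _ _ C hC μ _ t
  have hS : ∀ r : ℝ, MeasurableSet {x : ι → ℝ | r < ‖tetra Finset.univ C x‖} := fun r =>
    measurableSet_lt measurable_const (measurable_norm_tetra _ C)
  have hmp : MeasurePreserving (fun (z : ι → ℝ × Bool) i => boolInd (z i).2 * (z i).1)
      (Measure.pi fun i => (μ i).prod (bern p)) (Measure.pi fun i => thinning p (μ i)) :=
    measurePreserving_pi _ _ fun i => ⟨measurable_boolInd_mul, rfl⟩
  have harr := measurePreserving_arrowProdEquivProdArrow ℝ Bool ι μ (fun _ => bern p)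
  set T : Set ((ι → ℝ) × (ι → Bool)) := {z | (fun i => boolInd (z.2 i)) * z.1 ∈
    {x | (p : ℝ) ^ k / 2 * t < ‖tetra Finset.univ C x‖}}
  have hT : MeasurableSet T := measurable_bool_mul boolInd (hS _)
  -- The thinned product law is unfolded into the original variables times an independent Bernoulli
  -- cube, so that anticoncentration applies for each fixed `x`.
  rw [← hmp.measure_preimage (hS _).nullMeasurableSet]
  have e : (Measure.pi fun i => (μ i).prod (bern p))
      ((fun (z : ι → ℝ × Bool) i => boolInd (z i).2 * (z i).1) ⁻¹'
        {x | (p : ℝ) ^ k / 2 * t < ‖tetra Finset.univ C x‖})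
      = (Measure.pi μ).prod (Measure.pi fun _ => bern p) T := by
    rw [← harr.measure_preimage hT.nullMeasurableSet]
    rfl
  rw [e]
  refine mul_measure_le_prod _ _ (hS t) hT fun x hx => ?_
  refine (h (fun _ => p) boolInd (fun b => by cases b <;> simp [boolInd]) (fun i => ?_) C hC
    x).trans (measure_mono fun u hu => ?_)
  · simp [boolInd]
  · simp only [Set.mem_ofPred_eq] at hu hx
    have e : (fun _ : ι => (p : ℝ) * boolInd true + (1 - p) * boolInd false) * x
        = (p : ℝ) • x := by
      funext i
      simp [boolInd]
    rw [e, tetra_smul_arg _ hC, norm_smul, Real.norm_of_nonneg (by positivity)] at hu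
    refine lt_of_lt_of_le ?_ hu
    calc (p : ℝ) ^ k / 2 * t = p ^ k * t / 2 := by ring
      _ < _ := by gcongr

/-! ### Reduction of diagonal-free forms to tetrahedral polynomials. -/

section Reduction

variable {E : Type*} [NormedAddCommGroup E] [NormedSpace ℝ E] {k : ℕ}

/-- The coefficients of a diagonal-free form, grouped by the set of indices. -/
noncomputable def groupedCoeff (f : (Fin k → ℕ) →₀ E) (n : ℕ) (I : Finset (Fin n)) : E :=
  ∑ i ∈ f.support with Finset.univ.image i = I.map Fin.valEmbedding, f i

omit [NormedSpace ℝ E] in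
lemma groupedCoeff_eq_zero {f : (Fin k → ℕ) →₀ E} (hf : DiagonalFree f) (n : ℕ)
    (I : Finset (Fin n)) (hI : I.card ≠ k) : groupedCoeff f n I = 0 := by
  refine Finset.sum_eq_zero fun i hi => ?_
  have h := (Finset.mem_filter.1 hi).2
  refine hf i ?_
  by_contra hcon
  push Not at hcon
  have hinj : Function.Injective i := fun a b hab => by
    by_contra hne
    exact hcon a b hne hab
  have := congrArg Finset.card h
  rw [Finset.card_image_of_injective _ hinj, Finset.card_map] at this
  exact hI (by simpa using this.symm)

lemma exists_homogeneousQ_eq_tetra {f : (Fin k → ℕ) →₀ E} (hf : DiagonalFree f) :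
    ∃ n : ℕ, ∀ x : ℕ → ℝ,
      homogeneousQ f x = tetra Finset.univ (groupedCoeff f n) (fun i => x i) := by
  obtain ⟨n, hn⟩ : ∃ n : ℕ, ∀ i ∈ f.support, ∀ j, i j < n := by
    refine ⟨(f.support.sup fun i => Finset.univ.sup i) + 1, fun i hi j => Nat.lt_succ_of_le ?_⟩
    exact (Finset.le_sup (f := i) (Finset.mem_univ j)).trans
      (Finset.le_sup (f := fun i : Fin k → ℕ => Finset.univ.sup i) hi)
  refine ⟨n, fun x => ?_⟩
  have hfib : ∀ i ∈ f.support, ∃ I : Finset (Fin n),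
      Finset.univ.image i = I.map Fin.valEmbedding := by
    intro i hi
    refine ⟨Finset.univ.image fun j => ⟨i j, hn i hi j⟩, ?_⟩
    rw [Finset.map_eq_image, Finset.image_image]
    rfl
  choose! J hJ using hfib
  unfold tetra homogeneousQ multilinearQ Finsupp.sum
  rw [← Finset.sum_fiberwise_of_maps_to (t := Finset.univ.powerset) (g := J)
    (fun i _ => by simp)]
  refine Finset.sum_congr rfl fun I _ => ?_
  rw [groupedCoeff, Finset.smul_sum]
  have hset : f.support.filter (fun i => J i = I)
      = f.support.filter (fun i => Finset.univ.image i = I.map Fin.valEmbedding) := by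
    refine Finset.filter_congr fun i hi => ?_
    rw [hJ i hi, Finset.map_inj]
  rw [hset]
  refine Finset.sum_congr rfl fun i hi => ?_
  obtain ⟨hi, him⟩ := Finset.mem_filter.1 hi
  -- A tuple in the support has distinct entries, so its monomial is the product over its set of
  -- entries, each counted once.
  have hinj : Function.Injective i := fun a b hab => by
    by_contra hne
    exact Finsupp.mem_support_iff.1 hi (hf i ⟨a, b, hne, hab⟩)
  have h1 : ∏ l ∈ Finset.univ.image i, x l = ∏ j, x (i j) :=
    Finset.prod_image fun a _ b _ h => hinj h
  rw [him, Finset.prod_map] at h1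
  exact congrArg (· • f i) h1.symm

end Reduction

/-! ### Passage to product laws and the final assembly. -/

lemma IsIndepSymmetricSeq.measure_eq_pi {Ω : Type*} [MeasurableSpace Ω] {P : Measure Ω}
    [IsProbabilityMeasure P] {ξ : ℕ → Ω → ℝ} (hξ : IsIndepSymmetricSeq P ξ) (n : ℕ)
    {S : Set (Fin n → ℝ)} (hS : MeasurableSet S) :
    P {ω | (fun i : Fin n => ξ i ω) ∈ S} = Measure.pi (fun i : Fin n => P.map (ξ i)) S := by
  have h := hξ.indep.precomp (g := ((↑) : Fin n → ℕ)) Fin.val_injective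
  have hm : Measurable fun ω (i : Fin n) => ξ i ω :=
    measurable_pi_lambda _ fun i => hξ.measurable i
  rw [iIndepFun_iff_map_fun_eq_pi_map fun i => (hξ.measurable _).aemeasurable] at h
  rw [← h, Measure.map_apply hm hS]
  rfl

lemma IsIndepSymmetricSeq.map_neg {Ω : Type*} [MeasurableSpace Ω] {P : Measure Ω}
    {ξ : ℕ → Ω → ℝ} (hξ : IsIndepSymmetricSeq P ξ) (i : ℕ) :
    (P.map (ξ i)).map (fun x => -x) = P.map (ξ i) := by
  rw [Measure.map_map measurable_neg (hξ.measurable i)]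
  exact (hξ.symmetric i).map_eq

theorem mainTheorem6 (k : ℕ) (hk : 1 ≤ k) (A : ℝ) (hA : 0 < A) :
    ∃ K : ℝ, 0 < K ∧
      ∀ (E : Type*) [NormedAddCommGroup E] [NormedSpace ℝ E] [CompleteSpace E]
        (f : (Fin k → ℕ) →₀ E), DiagonalFree f →
      ∀ (Ω : Type*) [MeasurableSpace Ω] (P : Measure Ω) [IsProbabilityMeasure P]
        (Ω' : Type*) [MeasurableSpace Ω'] (P' : Measure Ω') [IsProbabilityMeasure P']
        (ξ : ℕ → Ω → ℝ) (η : ℕ → Ω' → ℝ),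
        IsIndepSymmetricSeq P ξ → IsIndepSymmetricSeq P' η →
        (∀ i : ℕ, ∀ t : ℝ, 0 < t →
          P.real {ω | t < |ξ i ω|} ≤ A * P'.real {ω | t < |η i ω|}) →
        ∀ t : ℝ, 0 < t →
          P.real {ω | t < ‖homogeneousQ f (fun i => ξ i ω)‖} ≤
            K * P'.real {ω | t < K * ‖homogeneousQ f (fun i => η i ω)‖} := by
  -- `1 / (A + 1)` rather than `1 / A`: besides `p * A ≤ 1`, thinning needs `p < 1` strictly, so
  -- that the Bernoulli variance is positive, and this must hold for small `A` too.
  set p : unitInterval := ⟨1 / (A + 1), by positivity, by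
    rw [div_le_one (by positivity)]; linarith⟩ with hp
  have hp0 : 0 < (p : ℝ) := by simp only [hp]; positivity
  have hp1 : (p : ℝ) < 1 := by
    simp only [hp]
    rw [div_lt_one (by positivity)]
    linarith
  have hpA : (p : ℝ) * A ≤ 1 := by
    simp only [hp]
    rw [div_mul_eq_mul_div, div_le_one (by positivity)]
    linarith
  obtain ⟨c₁, hc₁, h₁⟩ := exists_thinning_le k p hp0 hp1
  obtain ⟨c₂, hc₂, h₂⟩ := exists_comparison k
  obtain ⟨c, hc, hcc⟩ : ∃ c : ℝ, 0 < c ∧ ENNReal.ofReal c ≤ c₂ * c₁ := by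
    -- Truncating at 1 keeps the constant finite, so that it can be turned into a positive real.
    have hne : min (c₂ * c₁) 1 ≠ 0 := by simp [hc₁, hc₂]
    have htop : min (c₂ * c₁) 1 ≠ ⊤ := by simp
    exact ⟨(min (c₂ * c₁) 1).toReal, ENNReal.toReal_pos hne htop, by
      rw [ENNReal.ofReal_toReal htop]; exact min_le_left _ _⟩
  -- The product of the two threshold losses: `p ^ k / 2` from thinning and `2 ^ (k + 1)` from
  -- comparison.
  set r : ℝ := (p : ℝ) ^ k / 2 / 2 ^ (k + 1) with hr
  have hr0 : 0 < r := by positivity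
  refine ⟨max (1 / c) (1 / r), by positivity, ?_⟩
  intro E _ _ _ f hf Ω _ P _ Ω' _ P' _ ξ η hξ hη htail t ht
  obtain ⟨n, hn⟩ := exists_homogeneousQ_eq_tetra hf
  set C := groupedCoeff f n
  have hC : ∀ I, I.card ≠ k → C I = 0 := groupedCoeff_eq_zero hf n
  have hS : ∀ r : ℝ, MeasurableSet {x : Fin n → ℝ | r < ‖tetra Finset.univ C x‖} := fun r =>
    measurableSet_lt measurable_const (measurable_norm_tetra _ C)
  have := fun i : Fin n => Measure.isProbabilityMeasure_map (μ := P) (hξ.measurable i).aemeasurable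
  have := fun i : Fin n =>
    Measure.isProbabilityMeasure_map (μ := P') (hη.measurable i).aemeasurable
  have hdom : ∀ (i : Fin n) t, 0 < t →
      thinning p (P.map (ξ i)) {x | t < |x|} ≤ P'.map (η i) {x | t < |x|} := by
    intro i t ht
    have hSt : MeasurableSet {x : ℝ | t < |x|} := measurableSet_lt measurable_const measurable_abs
    rw [thinning_tail p _ ht, Measure.map_apply (hξ.measurable i) hSt,
      Measure.map_apply (hη.measurable i) hSt, ← ofReal_measureReal, ← ofReal_measureReal,
      ← ENNReal.ofReal_mul hp0.le]
    refine ENNReal.ofReal_le_ofReal ?_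
    calc (p : ℝ) * P.real {ω | t < |ξ i ω|} ≤ p * (A * P'.real {ω | t < |η i ω|}) := by
          gcongr
          exact htail i t ht
      _ = p * A * P'.real {ω | t < |η i ω|} := by ring
      _ ≤ 1 * P'.real {ω | t < |η i ω|} := by gcongr
      _ = _ := one_mul _
  have main : ENNReal.ofReal c * P {ω | t < ‖homogeneousQ f (fun i => ξ i ω)‖}
      ≤ P' {ω | r * t < ‖homogeneousQ f (fun i => η i ω)‖} := by
    simp only [hn]
    have e₁ := hξ.measure_eq_pi n (hS t)
    have e₂ := hη.measure_eq_pi n (hS (r * t))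
    simp only [Set.mem_ofPred_eq] at e₁ e₂
    rw [e₁, e₂]
    refine (mul_le_mul_left hcc _).trans ?_
    rw [mul_assoc]
    refine (mul_le_mul_right (h₁ C hC (fun i : Fin n => P.map (ξ i)) t) _).trans ?_
    refine (h₂ C hC _ (fun i : Fin n => P'.map (η i))
      (fun i => thinning_map_neg p (hξ.map_neg i)) (fun i => hη.map_neg i) hdom _).trans_eq ?_
    congr 2
    funext x
    rw [hr]
    ring_nf
  have mainR : c * P.real {ω | t < ‖homogeneousQ f (fun i => ξ i ω)‖}
      ≤ P'.real {ω | r * t < ‖homogeneousQ f (fun i => η i ω)‖} := by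
    have := ENNReal.toReal_mono (measure_ne_top _ _) main
    rwa [ENNReal.toReal_mul, ENNReal.toReal_ofReal hc.le] at this
  calc P.real {ω | t < ‖homogeneousQ f (fun i => ξ i ω)‖}
      ≤ 1 / c * P'.real {ω | r * t < ‖homogeneousQ f (fun i => η i ω)‖} := by
        rw [div_mul_eq_mul_div, one_mul, le_div_iff₀ hc]
        linarith
    _ ≤ _ := by
        refine mul_le_mul (le_max_left _ _) (measureReal_mono fun ω hω => ?_) measureReal_nonneg
          (by positivity)
        simp only [Set.mem_ofPred_eq] at hω ⊢
        calc t = 1 / r * (r * t) := by field_simp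
          _ < 1 / r * ‖homogeneousQ f (fun i => η i ω)‖ := by gcongr
          _ ≤ _ := by gcongr; exact le_max_right _ _
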